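/- Let $k\ge 3$ and, for elements $s,t$ of a monoid, let $\mathrm{prod}(s,t;n):=stst\cdots$ with $n$ factors. Let $$A_k=\langle a,b \mid \mathrm{prod}(a,b;k)=\mathrm{prod}(b,a;k)\rangle$$ be the Artin group of dihedral type, let $\Delta:=\mathrm{prod}(a,b;k)=\mathrm{prod}(b,a;k)$, and let $M^+:=\{a,b,ab,ba,\dots,\mathrm{prod}(a,b;k-1),\mathrm{prod}(b,a;k-1)\}$, where $\mathrm{prod}(a,b;n)$ and $\mathrm{prod}(b,a;n)$ are said to have length $n$. Let $x\in A_k$ be written in left normal form $$x=\Delta^r z_1\cdots z_m,\qquad r\in\mathbb{Z},\quad z_1,\dots,z_m\in M^+,$$ that is, with the number $m\ge 0$ of factors the least possible among all such expressions of $x$. For $1\le i\le k-1$ let $m_i$ be the number of indices $j$ such that the canonical factor $z_j$ has length $i$. Let $(p_0,\dots,p_{k-1})\in\mathbb{Z}^k$ be given by $p_0:=r$ and $p_i-p_{i-1}=m_{k-i}$ for each $i\in\{1,\dots,k-1\}$. Then the distance from the identity $e$ to $x$ in the word-length metric of $A_k$ with respect to the Artin generators $\{a,b,a^{-1},b^{-1}\}$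 is $$d(e,x)=\sum_{i=0}^{k-1}|p_i|.$$ -/

import Mathlib

namespace ArtinDihedral

/-- The alternating product `s t s t ⋯` with `n` factors. -/
def altProd {G : Type*} [Monoid G] (s t : G) : ℕ → G
  | 0 => 1
  | n + 1 => s * altProd t s n

/-- The defining relator of the Artin group of dihedral type, in the free group on
`a = false` and `b = true`: the word `(a b a ⋯) (b a b ⋯)⁻¹`, each bracket with `k` factors. -/
def rels (k : ℕ) : Set (FreeGroup Bool) :=
  {altProd (FreeGroup.of false) (FreeGroup.of true) k *
    (altProd (FreeGroup.of true) (FreeGroup.of false) k)⁻¹}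

/-- The Artin group of dihedral type `⟨a, b ∣ a b a ⋯ = b a b ⋯⟩`, with `k` factors
on each side. -/
abbrev Artin (k : ℕ) : Type := PresentedGroup (rels k)

/-- The generator `a`. -/
def a (k : ℕ) : Artin k := PresentedGroup.of false

/-- The generator `b`. -/
def b (k : ℕ) : Artin k := PresentedGroup.of true

/-- The set of Artin generators. -/
def gens (k : ℕ) : Set (Artin k) := {a k, b k, (a k)⁻¹, (b k)⁻¹}

/-- The Garside element `Δ`. -/
def garside (k : ℕ) : Artin k := altProd (a k) (b k) k

/-- `z` is one of the two alternating products of length `n` in the generators `a` and `b`. -/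
def HasLength (k n : ℕ) (z : Artin k) : Prop :=
  z = altProd (a k) (b k) n ∨ z = altProd (b k) (a k) n

/-- The set `M⁺ = {a, b, ab, ba, …}` of alternating products of length between `1` and `k - 1`. -/
def canonicalFactors (k : ℕ) : Set (Artin k) :=
  {z | ∃ n : ℕ, 1 ≤ n ∧ n < k ∧ HasLength k n z}

/-- `x = Δ ^ r * z₁ * ⋯ * zₘ` with all `zⱼ` in `M⁺`. -/
def IsLeftDecomposition {k : ℕ} (x : Artin k) (r : ℤ) (z : List (Artin k)) : Prop :=
  (∀ y ∈ z, y ∈ canonicalFactors k) ∧ x = garside k ^ r * z.prod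

/-- The left normal form of `x`: a decomposition `x = Δ ^ r * z₁ * ⋯ * zₘ` with all `zⱼ` in `M⁺`,
in which the number `m` of factors is the least possible. -/
def IsLeftNormalForm {k : ℕ} (x : Artin k) (r : ℤ) (z : List (Artin k)) : Prop :=
  IsLeftDecomposition x r z ∧
    ∀ (r' : ℤ) (z' : List (Artin k)), IsLeftDecomposition x r' z' → z.length ≤ z'.length

open Classical in
/-- The number of factors of length `i` in the list `z`. -/
noncomputable def numOfLength {k : ℕ} (z : List (Artin k)) (i : ℕ) : ℕ :=
  z.countP (fun y => decide (HasLength k i y))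

/-- The numbers of letters of the words in `S` that lead from `x` to `y` by right multiplication,
that is, the lengths of the edge paths from `x` to `y` in the Cayley graph. -/
def pathLengths {G : Type*} [Group G] (S : Set G) (x y : G) : Set ℕ :=
  {n | ∃ w : List G, (∀ g ∈ w, g ∈ S) ∧ x * w.prod = y ∧ w.length = n}

/-- The word-length metric on `G` with respect to `S`. -/
noncomputable def wordDist {G : Type*} [Group G] (S : Set G) (x y : G) : ℕ :=
  sInf (pathLengths S x y)

/-- The infimum in the word-length metric of the Artin generators is over a non-empty set. -/
theorem pathLengths_gens_nonempty (k : ℕ) (x y : Artin k) :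
    (pathLengths (gens k) x y).Nonempty := by
  have h : x⁻¹ * y ∈ Subgroup.closure (Set.range (PresentedGroup.of (rels := rels k))) := by
    rw [PresentedGroup.closure_range_of]
    trivial
  rw [← Subgroup.mem_toSubmonoid, Subgroup.closure_toSubmonoid] at h
  obtain ⟨l, hl, hp⟩ := Submonoid.exists_list_of_mem_closure h
  refine ⟨l.length, l, fun g hg => ?_, by rw [hp]; group, rfl⟩
  rcases hl g hg with ⟨c, hc⟩ | ⟨c, hc⟩
  · cases c
    · exact Or.inl hc.symm
    · exact Or.inr (Or.inl hc.symm)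
  · have hc' : g = (PresentedGroup.of (rels := rels k) c)⁻¹ := by rw [hc, inv_inv]
    cases c
    · exact Or.inr (Or.inr (Or.inl hc'))
    · exact Or.inr (Or.inr (Or.inr hc'))

end ArtinDihedral

/-! ### Normal forms and multiplication by one letter. -/

namespace ArtinDihedral

/-! The group acts on formal normal forms, and the length of `x` is read off from the image of the
trivial one. A generator acts by the permutation `mulGen`; the relation holds because an alternating
word of `k` letters acts as `Δ`, whatever its first letter (`mulAlt_garside`). Evaluation in the
group is equivariant (`val_act`), so `x` is recovered from its normal form.

Let `p i` be the exponent of `Δ` plus the number of factors of length at least `k - i`. A generator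
raises exactly one `p i` by one (`exists_raises_mulGen`), so a word for `x` has at least `∑ |p i|`
letters. Conversely, if the first factor has length `l`, one generator raises `p (k - l - 1)` and
the inverse of the other lowers `p (k - l)`. As `p (k - l - 1) < p (k - l)`, one of these moves goes
towards zero (`exists_size_lt`), and descent gives a word with `∑ |p i|` letters.

Finally, a decomposition with fewest factors has the exponent and the factor lengths of this normal
form (`act_of_isLeftNormalForm`). -/

/-- `⟨r, e, L⟩` stands for the element `z₁ ⋯ zₘ * Δ ^ r`, where the `zᵢ` are alternating products
with lengths `L`, the last letter of each being the first letter of the next, and where `e` is the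
letter by which `z₁` can be extended to the left. -/
structure NormalForm where
  exp : ℤ
  letter : Bool
  lens : List ℕ

namespace NormalForm

/-- The normal form with the given data, the letter being normalized if there are no factors. -/
def ofData (r : ℤ) (e : Bool) (L : List ℕ) : NormalForm := ⟨r, if L = [] then false else e, L⟩

/-- Lengths are in the range `1, …, k - 1`, and the letter is normalized. -/
def Valid (k : ℕ) (S : NormalForm) : Prop :=
  (∀ l ∈ S.lens, 1 ≤ l ∧ l < k) ∧ (S.lens = [] → S.letter = false)

/-- Left multiplication by a generator. -/
def mulGen (k : ℕ) (g : Bool) : NormalForm → NormalForm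
  | ⟨r, _, []⟩ => ⟨r, !g, [1]⟩
  | ⟨r, e, l :: L⟩ =>
    if g = e then
      if l + 1 < k then ⟨r, !e, (l + 1) :: L⟩ else ofData (r + 1) e L
    else ⟨r, e, 1 :: l :: L⟩

/-- Left multiplication by the inverse of a generator. -/
def invMulGen (k : ℕ) (g : Bool) : NormalForm → NormalForm
  | ⟨r, _, []⟩ => ⟨r - 1, g, [k - 1]⟩
  | ⟨r, e, l :: L⟩ =>
    if g = e then ⟨r - 1, e, (k - 1) :: l :: L⟩
    else if l = 1 then ofData r e L else ⟨r, g, (l - 1) :: L⟩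

variable {k : ℕ}

theorem valid_ofData {r : ℤ} {e : Bool} {L : List ℕ} (h : ∀ l ∈ L, 1 ≤ l ∧ l < k) :
    Valid k (ofData r e L) :=
  ⟨h, fun hL => by simp_all [ofData]⟩

theorem Valid.mulGen (hk : 2 ≤ k) {S : NormalForm} (h : S.Valid k) (g : Bool) :
    (S.mulGen k g).Valid k := by
  obtain ⟨r, e, _ | ⟨l, L⟩⟩ := S
  · exact ⟨by simp [NormalForm.mulGen]; omega, by simp [NormalForm.mulGen]⟩
  · have h1 := h.1
    simp only [List.mem_cons, forall_eq_or_imp] at h1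
    unfold NormalForm.mulGen
    dsimp only
    split_ifs
    · exact ⟨by simp only [List.mem_cons, forall_eq_or_imp]; exact ⟨by omega, h1.2⟩, by simp⟩
    · exact valid_ofData h1.2
    · refine ⟨?_, by simp⟩
      simp only [List.mem_cons, forall_eq_or_imp]
      exact ⟨by omega, h1⟩

theorem Valid.invMulGen (hk : 2 ≤ k) {S : NormalForm} (h : S.Valid k) (g : Bool) :
    (S.invMulGen k g).Valid k := by
  obtain ⟨r, e, _ | ⟨l, L⟩⟩ := S
  · exact ⟨by simp [NormalForm.invMulGen]; omega, by simp [NormalForm.invMulGen]⟩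
  · have h1 := h.1
    simp only [List.mem_cons, forall_eq_or_imp] at h1
    unfold NormalForm.invMulGen
    dsimp only
    split_ifs
    · refine ⟨?_, by simp⟩
      simp only [List.mem_cons, forall_eq_or_imp]
      exact ⟨by omega, h1⟩
    · exact valid_ofData h1.2
    · exact ⟨by simp only [List.mem_cons, forall_eq_or_imp]; exact ⟨by omega, h1.2⟩, by simp⟩

theorem invMulGen_mulGen (hk : 2 ≤ k) {S : NormalForm} (h : S.Valid k) (g : Bool) :
    (S.mulGen k g).invMulGen k g = S := by
  obtain ⟨r, e, _ | ⟨l, L⟩⟩ := S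
  · have := h.2 rfl
    cases g <;> simp_all [mulGen, invMulGen, ofData]
  · have h1 := h.1 l (by simp)
    unfold mulGen
    dsimp only
    split_ifs with h2 h3
    · have : l ≠ 0 := by omega
      subst h2
      simp [invMulGen, this]
    · have : k - 1 = l := by omega
      rcases L with _ | ⟨l', L⟩ <;> simp [invMulGen, ofData, h2, this]
    · simp [invMulGen, h2, ofData]

theorem mulGen_invMulGen (hk : 2 ≤ k) {S : NormalForm} (h : S.Valid k) (g : Bool) :
    (S.invMulGen k g).mulGen k g = S := by
  have hk' : ¬ (k - 1 + 1 < k) := by omega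
  obtain ⟨r, e, _ | ⟨l, L⟩⟩ := S
  · have := h.2 rfl
    simp_all [mulGen, invMulGen, ofData]
  · have h1 := h.1 l (by simp)
    unfold invMulGen
    dsimp only
    split_ifs with h2 h3
    · simp [mulGen, h2, hk', ofData]
    · have : e = !g := by cases e <;> cases g <;> simp_all
      subst h3 this
      rcases L with _ | ⟨l', L⟩ <;> simp [mulGen, ofData]
    · have : e = !g := by cases e <;> cases g <;> simp_all
      have h4 : l - 1 + 1 = l := by omega
      subst this
      simp [mulGen, h4, h1.2]

/-! ### Multiplication by alternating words. -/

/-- Left multiplication by the alternating product of length `n` with first letter `c`. -/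
def mulAlt (k : ℕ) : Bool → ℕ → NormalForm → NormalForm
  | _, 0, S => S
  | c, n + 1, S => (mulAlt k (!c) n S).mulGen k c

theorem mulAlt_add (c : Bool) (m n : ℕ) (S : NormalForm) :
    mulAlt k c (m + n) S = mulAlt k c m (mulAlt k (c ^^ m.bodd) n S) := by
  induction m generalizing c with
  | zero => simp [mulAlt]
  | succ m ih =>
    have : ((!c) ^^ m.bodd) = (c ^^ (m + 1).bodd) := by
      rw [Nat.bodd_succ]; cases c <;> cases m.bodd <;> rfl
    rw [Nat.succ_add, mulAlt, ih, mulAlt, this]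

/-- For `n ≥ 1`, `he` says that the last letter of the word is `e`, so every letter lengthens the
first factor. -/
theorem mulAlt_extend {c e : Bool} {l n : ℕ} {r : ℤ} {L : List ℕ}
    (he : e = ((!c) ^^ n.bodd)) (hn : l + n < k) :
    mulAlt k c n ⟨r, e, l :: L⟩ = ⟨r, !c, (l + n) :: L⟩ := by
  induction n generalizing c with
  | zero => simp [mulAlt, he]
  | succ n ih =>
    have h1 : e = ((!!c) ^^ n.bodd) := by
      rw [he, Nat.bodd_succ]; cases c <;> cases n.bodd <;> rfl
    rw [mulAlt, ih h1 (by omega), mulGen, if_pos (by simp), if_pos (by omega)]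
    simp [Nat.add_assoc]

/-- Here the last letter of the word is not `e`: it opens a factor, which the other letters
lengthen. -/
theorem mulAlt_push {c e : Bool} {n : ℕ} {r : ℤ} {L : List ℕ}
    (he : L = [] ∨ e = (c ^^ (n + 1).bodd)) (hn : n + 1 < k) :
    mulAlt k c (n + 1) ⟨r, e, L⟩ = ⟨r, !c, (n + 1) :: L⟩ := by
  have key : ∀ c : Bool, (L = [] ∨ e = !c) →
      mulAlt k c 1 ⟨r, e, L⟩ = ⟨r, !c, 1 :: L⟩ := by
    rintro c h
    rcases L with _ | ⟨l, L⟩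
    · simp [mulAlt, mulGen]
    · have h : e = !c := by simpa using h
      subst h
      simp [mulAlt, mulGen]
  rw [mulAlt_add, key, mulAlt_extend _ (by omega), Nat.add_comm]
  · cases c <;> cases n.bodd <;> rfl
  · rw [Nat.bodd_succ] at he
    rcases he with he | he
    · exact Or.inl he
    · right; rw [he]; cases c <;> cases n.bodd <;> rfl

/-- An alternating product that extends the first factor to `Δ`. -/
theorem mulAlt_pop {c : Bool} {l n : ℕ} {r : ℤ} {L : List ℕ} (h : l + n + 1 = k) :
    mulAlt k c (n + 1) ⟨r, (c ^^ n.bodd), l :: L⟩ = ofData (r + 1) c L := by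
  rw [mulAlt, mulAlt_extend (by simp) (by omega), mulGen, if_pos (by simp), if_neg (by omega)]
  simp

theorem mulAlt_pop_push {c : Bool} {l n m : ℕ} {r : ℤ} {L : List ℕ} (h : l + n + 1 = k)
    (hm : m + 1 < k) :
    mulAlt k c (m + 1 + (n + 1)) ⟨r, (c ^^ (m + n + 1).bodd), l :: L⟩ =
      ⟨r + 1, !c, (m + 1) :: L⟩ := by
  have : (c ^^ (m + n + 1).bodd) = ((c ^^ (m + 1).bodd) ^^ n.bodd) := by
    simp only [Nat.bodd_succ, Nat.bodd_add]
    cases c <;> cases n.bodd <;> cases m.bodd <;> rfl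
  rw [mulAlt_add, this, mulAlt_pop h, ofData, mulAlt_push _ hm]
  by_cases hL : L = [] <;> simp [hL]

/-- Either the word builds a new factor that grows to `Δ`, or its last `k - l` letters complete the
first factor to `Δ` and the other `l` letters build a factor of the same length `l`. The result is
independent of `c`, which is the defining relation. -/
theorem mulAlt_garside (hk : 2 ≤ k) {r : ℤ} {e : Bool} {L : List ℕ}
    (h : Valid k ⟨r, e, L⟩) (c : Bool) :
    mulAlt k c k ⟨r, e, L⟩ = ofData (r + 1) (e ^^ k.bodd) L := by
  obtain ⟨n, rfl⟩ := Nat.exists_eq_add_of_le' hk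
  by_cases hL : L = [] ∨ e = (c ^^ (n + 2).bodd)
  · rw [mulAlt, mulAlt_push _ (by omega), mulGen, if_pos (by simp), if_neg (by omega)]
    · rcases hL with rfl | rfl
      · simp [ofData]
      · simp
    · rcases hL with hL | hL
      · exact Or.inl hL
      · right; rw [hL, Nat.bodd_succ]; cases c <;> cases (n + 1).bodd <;> rfl
  · push Not at hL
    obtain ⟨h1, h2⟩ := hL
    obtain ⟨l, L', rfl⟩ := List.exists_cons_of_ne_nil h1
    have hl := h.1 l (by simp)
    obtain ⟨m, rfl⟩ := Nat.exists_eq_add_of_le' hl.1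
    obtain ⟨n', hn'⟩ : ∃ n', m + 1 + n' + 1 = n + 2 := ⟨n - m, by omega⟩
    have he : e = (c ^^ (m + n' + 1).bodd) := by
      rw [show m + n' + 1 = n + 1 by omega]
      simpa only [Nat.bodd_succ (n + 1), Bool.xor_not, Bool.not_not] using Bool.eq_not.mpr h2
    have := mulAlt_pop_push (c := c) (r := r) (L := L') hn' (m := m) (by omega)
    rw [← he, show m + 1 + (n' + 1) = n + 2 by omega] at this
    rw [this]
    have : (e ^^ (n + 2).bodd) = !c := by
      rw [Bool.eq_not.mpr h2]
      cases c <;> cases (n + 2).bodd <;> rfl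
    rw [this]
    simp [ofData]

/-- Multiplication by an alternating product either adds a new factor or does not increase the
number of factors. -/
theorem mulAlt_dichotomy {n : ℕ} (hn : 1 ≤ n) (hn' : n < k) {r : ℤ} {e : Bool} {L : List ℕ}
    (h : Valid k ⟨r, e, L⟩) (c : Bool) :
    ((mulAlt k c n ⟨r, e, L⟩).exp = r ∧ (mulAlt k c n ⟨r, e, L⟩).lens = n :: L) ∨
      (mulAlt k c n ⟨r, e, L⟩).lens.length ≤ L.length := by
  obtain ⟨n, rfl⟩ := Nat.exists_eq_add_of_le' hn
  by_cases hL : L = [] ∨ e = (c ^^ (n + 1).bodd)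
  · left
    rw [mulAlt_push hL hn']
    exact ⟨rfl, rfl⟩
  · right
    push Not at hL
    obtain ⟨h1, h2⟩ := hL
    obtain ⟨l, L', rfl⟩ := List.exists_cons_of_ne_nil h1
    have hl := h.1 l (by simp)
    have he : e = (c ^^ n.bodd) := by
      simpa only [Nat.bodd_succ, Bool.xor_not, Bool.not_not] using Bool.eq_not.mpr h2
    -- The word, of `n + 1` letters, fits into the first factor, completes it to `Δ`, or overflows
    -- into a new factor.
    rcases lt_trichotomy (l + n + 1) k with hlt | heq | hgt
    · rw [mulAlt_extend _ (by omega)]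
      · simp
      · rw [he, Nat.bodd_succ]; cases c <;> cases n.bodd <;> rfl
    · rw [he, mulAlt_pop heq]
      simp [ofData]
    · obtain ⟨n', hn''⟩ : ∃ n', l + n' + 1 = k := ⟨k - l - 1, by omega⟩
      obtain ⟨m, hm⟩ : ∃ m, n = m + n' + 1 := ⟨n - n' - 1, by omega⟩
      have := mulAlt_pop_push (c := c) (r := r) (L := L') hn'' (m := m) (by omega)
      rw [← hm, ← he, show m + 1 + (n' + 1) = n + 1 by omega] at this
      rw [this]
      simp

end NormalForm
end ArtinDihedral

/-! ### The coordinate vector and its sum of absolute values. -/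

namespace ArtinDihedral
namespace NormalForm

variable {k : ℕ}

/-- The `i`-th coordinate of the vector of a normal form: the exponent of `Δ` plus the number of
factors of length at least `k - i`. -/
def level (k : ℕ) (S : NormalForm) (i : ℕ) : ℤ :=
  S.exp + (S.lens.countP (fun l => decide (k ≤ l + i)) : ℕ)

/-- The sum of the absolute values of the coordinates. -/
def size (k : ℕ) (S : NormalForm) : ℤ := ∑ i ∈ Finset.range k, |S.level k i|

theorem size_nonneg (S : NormalForm) : 0 ≤ S.size k :=
  Finset.sum_nonneg fun _ _ => abs_nonneg _

/-- `T` arises from `S` by raising the `i`-th coordinate by one. -/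
def Raises (k i : ℕ) (S T : NormalForm) : Prop :=
  i < k ∧ ∀ j < k, T.level k j = S.level k j + if j = i then 1 else 0

theorem Raises.size_sub {i : ℕ} {S T : NormalForm} (h : Raises k i S T) :
    T.size k - S.size k = |S.level k i + 1| - |S.level k i| := by
  have hi : i ∈ Finset.range k := Finset.mem_range.mpr h.1
  rw [size, size, ← Finset.sum_sub_distrib, Finset.sum_eq_single_of_mem i hi]
  · rw [h.2 i h.1, if_pos rfl]
  · intro j hj hji
    rw [h.2 j (Finset.mem_range.mp hj), if_neg hji, add_zero, sub_self]

theorem Raises.abs_size_sub {i : ℕ} {S T : NormalForm} (h : Raises k i S T) :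
    |T.size k - S.size k| ≤ 1 := by
  rw [h.size_sub]
  simpa using abs_abs_sub_abs_le (S.level k i + 1) (S.level k i)

theorem Raises.size_lt {i : ℕ} {S T : NormalForm} (h : Raises k i S T)
    (hi : S.level k i < 0) : T.size k + 1 = S.size k := by
  have := h.size_sub
  rw [abs_of_neg hi, abs_of_nonpos (by omega)] at this
  omega

theorem Raises.lt_size {i : ℕ} {S T : NormalForm} (h : Raises k i S T)
    (hi : 0 < T.level k i) : S.size k + 1 = T.size k := by
  have h1 := h.2 i h.1
  rw [if_pos rfl] at h1
  have := h.size_sub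
  rw [abs_of_nonneg (by omega), abs_of_nonneg (by omega)] at this
  omega

theorem raises_push {r : ℤ} {e e' : Bool} {L : List ℕ} (hk : 2 ≤ k) :
    Raises k (k - 1) ⟨r, e, L⟩ ⟨r, e', 1 :: L⟩ := by
  refine ⟨by omega, fun j hj => ?_⟩
  by_cases h : j = k - 1
  · have : k ≤ 1 + (k - 1) := by omega
    simp [level, this, h, add_assoc]
  · have : ¬ k ≤ 1 + j := by omega
    simp [level, this, h]

theorem raises_extend {r : ℤ} {e e' : Bool} {l : ℕ} {L : List ℕ} (hl : l + 1 < k) :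
    Raises k (k - l - 1) ⟨r, e, l :: L⟩ ⟨r, e', (l + 1) :: L⟩ := by
  refine ⟨by omega, fun j hj => ?_⟩
  by_cases h : j = k - l - 1
  · have h1 : k ≤ l + 1 + j := by omega
    have h2 : ¬ k ≤ l + j := by omega
    simp only [level, List.countP_cons, h1, h2, decide_true, decide_false, if_pos h]
    simp [add_assoc]
  · have h1 : k ≤ l + 1 + j ↔ k ≤ l + j := by omega
    simp [level, List.countP_cons, h1, h]

/-- The new exponent raises all coordinates; the loss of a factor of length `k - 1` lowers all but
the zeroth. -/
theorem raises_pop {r : ℤ} {e e' : Bool} {L : List ℕ} (hk : 2 ≤ k) :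
    Raises k 0 ⟨r, e, (k - 1) :: L⟩ ⟨r + 1, e', L⟩ := by
  refine ⟨by omega, fun j hj => ?_⟩
  by_cases h : j = 0
  · have h1 : ¬ k ≤ k - 1 := by omega
    simp [level, h1, h]
    ring
  · have h1 : k ≤ k - 1 + j := by omega
    simp [level, h1, h]
    ring

theorem exists_raises_mulGen (hk : 2 ≤ k) {S : NormalForm} (h : S.Valid k) (g : Bool) :
    ∃ i, Raises k i S (S.mulGen k g) := by
  obtain ⟨r, e, _ | ⟨l, L⟩⟩ := S
  · exact ⟨_, raises_push hk⟩
  · have h1 := h.1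
    simp only [List.mem_cons, forall_eq_or_imp] at h1
    unfold mulGen
    dsimp only
    split_ifs with h2 h3
    · exact ⟨_, raises_extend h3⟩
    · have : l = k - 1 := by omega
      subst this
      exact ⟨_, raises_pop hk⟩
    · exact ⟨_, raises_push hk⟩

theorem abs_size_mulGen_sub (hk : 2 ≤ k) {S : NormalForm} (h : S.Valid k) (g : Bool) :
    |(S.mulGen k g).size k - S.size k| ≤ 1 :=
  (exists_raises_mulGen hk h g).choose_spec.abs_size_sub

theorem abs_size_invMulGen_sub (hk : 2 ≤ k) {S : NormalForm} (h : S.Valid k) (g : Bool) :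
    |(S.invMulGen k g).size k - S.size k| ≤ 1 := by
  have := abs_size_mulGen_sub hk (h.invMulGen hk g) g
  rwa [mulGen_invMulGen hk h, abs_sub_comm] at this

/-- The first factor is counted from coordinate `k - l` on. Strictness excludes that both moves
available at this factor lead away from zero. -/
theorem level_lt_level {r : ℤ} {e : Bool} {l : ℕ} {L : List ℕ} (h2 : l < k) :
    level k ⟨r, e, l :: L⟩ (k - l - 1) < level k ⟨r, e, l :: L⟩ (k - l) := by
  have h3 : k ≤ l + (k - l) := by omega
  have h4 : ¬ k ≤ l + (k - l - 1) := by omega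
  have h5 : L.countP (fun l' => decide (k ≤ l' + (k - l - 1))) ≤
      L.countP (fun l' => decide (k ≤ l' + (k - l))) := by
    refine List.countP_mono_left fun x _ hx => ?_
    simp only [decide_eq_true_eq] at hx ⊢
    omega
  simp only [level, List.countP_cons, h3, h4, decide_true, decide_false]
  simp
  omega

/-- Every normal form but the trivial one can be made smaller by multiplication with a generator
or with its inverse. -/
theorem exists_size_lt (hk : 2 ≤ k) {S : NormalForm} (h : S.Valid k) :
    S = ⟨0, false, []⟩ ∨
      ∃ g, (S.mulGen k g).size k + 1 = S.size k ∨ (S.invMulGen k g).size k + 1 = S.size k := by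
  obtain ⟨r, e, _ | ⟨l, L⟩⟩ := S
  · have := h.2 rfl
    dsimp only at this
    subst this
    rcases lt_trichotomy r 0 with hr | rfl | hr
    · refine Or.inr ⟨false, Or.inl ((raises_push hk).size_lt ?_)⟩
      simpa [level] using hr
    · exact Or.inl rfl
    · refine Or.inr ⟨false, Or.inr (Raises.lt_size (i := 0) ?_ ?_)⟩
      · have := raises_pop (k := k) (r := r - 1) (e := false) (e' := false) (L := []) hk
        rwa [sub_add_cancel] at this
      · simpa [level] using hr
  · right
    have hl := h.1 l (by simp)
    have hlt := level_lt_level (r := r) (e := e) (L := L) hl.2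
    rcases lt_or_ge 0 (level k ⟨r, e, l :: L⟩ (k - l)) with hp | hp
    · refine ⟨!e, Or.inr (Raises.lt_size (i := k - l) ?_ hp)⟩
      simp only [invMulGen]
      rw [if_neg (by simp)]
      split_ifs with h1
      · subst h1
        exact raises_push hk
      · have := raises_extend (k := k) (r := r) (e := !e) (e' := e) (l := l - 1) (L := L)
          (by omega)
        rwa [show l - 1 + 1 = l by omega, show k - (l - 1) - 1 = k - l by omega] at this
    · refine ⟨e, Or.inl (Raises.size_lt (i := k - l - 1) ?_ (by omega))⟩
      simp only [mulGen, if_true]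
      split_ifs with h1
      · exact raises_extend h1
      · have h2 : l = k - 1 := by omega
        subst h2
        rw [show k - (k - 1) - 1 = 0 by omega]
        exact raises_pop hk

end NormalForm
end ArtinDihedral

/-! ### Alternating products in the group and the value of a normal form. -/

namespace ArtinDihedral

theorem map_altProd {G H F : Type*} [Monoid G] [Monoid H] [FunLike F G H] [MonoidHomClass F G H]
    (f : F) (s t : G) (n : ℕ) : f (altProd s t n) = altProd (f s) (f t) n := by
  induction n generalizing s t with
  | zero => simp [altProd]
  | succ n ih => simp [altProd, ih]

variable {k : ℕ}

/-- The Artin generators, indexed by their letters. -/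
def gen (k : ℕ) (c : Bool) : Artin k := PresentedGroup.of c

/-- The alternating product of length `n` with first letter `c`. -/
def alt (k : ℕ) (c : Bool) (n : ℕ) : Artin k := altProd (gen k c) (gen k !c) n

theorem alt_zero (c : Bool) : alt k c 0 = 1 := rfl

theorem alt_succ (c : Bool) (n : ℕ) : alt k c (n + 1) = gen k c * alt k (!c) n := by
  simp [alt, altProd]

theorem hasLength_iff {n : ℕ} {y : Artin k} : HasLength k n y ↔ ∃ c, y = alt k c n := by
  rw [Bool.exists_bool]; rfl

theorem alt_eq_garside (c : Bool) : alt k c k = garside k := by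
  cases c
  · rfl
  · refine (mul_inv_eq_one.mp ?_).symm
    have := PresentedGroup.one_of_mem (rels := rels k) (Set.mem_singleton _)
    rw [map_mul, map_inv, map_altProd, map_altProd] at this
    exact this

theorem alt_add (c : Bool) (m n : ℕ) :
    alt k c (m + n) = alt k c m * alt k (c ^^ m.bodd) n := by
  induction m generalizing c with
  | zero => simp [alt_zero]
  | succ m ih =>
    have : ((!c) ^^ m.bodd) = (c ^^ (m + 1).bodd) := by
      rw [Nat.bodd_succ]; cases c <;> cases m.bodd <;> rfl
    rw [Nat.succ_add, alt_succ, ih, alt_succ, this, mul_assoc]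

/-- An alternating word of `k + 1` letters has `Δ` both as a prefix and as a suffix. -/
theorem garside_mul_gen (c : Bool) :
    garside k * gen k c = gen k (c ^^ k.bodd) * garside k := by
  have h1 := alt_add (k := k) (c ^^ k.bodd) k 1
  have h2 := alt_add (k := k) (c ^^ k.bodd) 1 k
  rw [add_comm, h2, alt_eq_garside, alt_eq_garside] at h1
  simpa [alt_succ, alt_zero] using h1.symm

theorem garside_mul_alt (c : Bool) (n : ℕ) :
    garside k * alt k c n = alt k (c ^^ k.bodd) n * garside k := by
  induction n generalizing c with
  | zero => simp [alt_zero]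
  | succ n ih =>
    rw [alt_succ, alt_succ, ← mul_assoc, garside_mul_gen, mul_assoc, ih, mul_assoc]
    simp

namespace NormalForm

/-- The product of the factors with lengths `L`, where the first one can be extended to the left
by the letter `e`. -/
def posVal (k : ℕ) : Bool → List ℕ → Artin k
  | _, [] => 1
  | e, l :: L => alt k (!e) l * posVal k (e ^^ (l + 1).bodd) L

/-- The group element that a normal form stands for. -/
def val (k : ℕ) (S : NormalForm) : Artin k := posVal k S.letter S.lens * garside k ^ S.exp

theorem garside_mul_posVal (e : Bool) (L : List ℕ) :
    garside k * posVal k e L = posVal k (e ^^ k.bodd) L * garside k := by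
  induction L generalizing e with
  | nil => simp [posVal]
  | cons l L ih =>
    rw [posVal, posVal, ← mul_assoc, garside_mul_alt, mul_assoc, ih, mul_assoc,
      ← Bool.not_xor, Bool.xor_right_comm]

theorem val_ofData (r : ℤ) (e : Bool) (L : List ℕ) :
    (ofData r e L).val k = posVal k e L * garside k ^ r := by
  by_cases h : L = [] <;> simp [val, ofData, h, posVal]

theorem val_mulGen {S : NormalForm} (h : S.Valid k) (g : Bool) :
    (S.mulGen k g).val k = gen k g * S.val k := by
  obtain ⟨r, e, _ | ⟨l, L⟩⟩ := S
  · simp [mulGen, val, posVal, alt_succ, alt_zero]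
  · have hl := h.1 l (by simp)
    unfold mulGen
    dsimp only
    split_ifs with h1 h2
    · subst h1
      simp only [val, posVal, ← mul_assoc]
      rw [alt_succ, Bool.not_not, Nat.bodd_succ (l + 1)]
      simp
    · subst h1
      have h3 : l + 1 = k := by omega
      rw [val_ofData]
      simp only [val, posVal]
      rw [← mul_assoc, ← mul_assoc, ← alt_succ, h3, alt_eq_garside, garside_mul_posVal, mul_assoc,
        ← zpow_one_add, add_comm r, Bool.xor_assoc, Bool.xor_self, Bool.xor_false]
    · have : e = !g := by cases e <;> cases g <;> simp_all
      subst this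
      simp [val, posVal, alt_succ, alt_zero, mul_assoc]

end NormalForm
end ArtinDihedral

/-! ### The action on normal forms and the word length. -/

namespace ArtinDihedral
namespace NormalForm

variable {k : ℕ}

/-- The permutation of the valid normal forms induced by a generator. -/
def genPerm (hk : 2 ≤ k) (g : Bool) : Equiv.Perm {S : NormalForm // S.Valid k} where
  toFun S := ⟨S.1.mulGen k g, S.2.mulGen hk g⟩
  invFun S := ⟨S.1.invMulGen k g, S.2.invMulGen hk g⟩
  left_inv S := Subtype.ext (invMulGen_mulGen hk S.2 g)
  right_inv S := Subtype.ext (mulGen_invMulGen hk S.2 g)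

theorem altProd_genPerm (hk : 2 ≤ k) (c : Bool) (n : ℕ) (S : {S : NormalForm // S.Valid k}) :
    (altProd (genPerm hk c) (genPerm hk !c) n S).1 = mulAlt k c n S.1 := by
  induction n generalizing c with
  | zero => rfl
  | succ n ih =>
    have := ih (!c)
    rw [Bool.not_not] at this
    rw [mulAlt, ← this]
    rfl

theorem lift_genPerm_rels (hk : 2 ≤ k) : ∀ w ∈ rels k, FreeGroup.lift (genPerm hk) w = 1 := by
  rintro w rfl
  rw [map_mul, map_inv, map_altProd, map_altProd, mul_inv_eq_one]
  simp only [FreeGroup.lift_apply_of]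
  refine Equiv.ext fun S => Subtype.ext ?_
  have h1 := altProd_genPerm hk false k S
  have h2 := altProd_genPerm hk true k S
  rw [mulAlt_garside hk S.2] at h1 h2
  exact h1.trans h2.symm

/-- The action of the Artin group on normal forms. -/
def act (hk : 2 ≤ k) : Artin k →* Equiv.Perm {S : NormalForm // S.Valid k} :=
  PresentedGroup.toGroup (lift_genPerm_rels hk)

theorem act_gen (hk : 2 ≤ k) (c : Bool) : act hk (gen k c) = genPerm hk c :=
  PresentedGroup.toGroup.of _

theorem act_alt (hk : 2 ≤ k) (c : Bool) (n : ℕ) (S : {S : NormalForm // S.Valid k}) :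
    (act hk (alt k c n) S).1 = mulAlt k c n S.1 := by
  rw [alt, map_altProd, act_gen, act_gen, altProd_genPerm]

theorem act_gen_inv (hk : 2 ≤ k) (c : Bool) (S : {S : NormalForm // S.Valid k}) :
    (act hk (gen k c)⁻¹ S).1 = S.1.invMulGen k c := by
  rw [map_inv, act_gen]
  rfl

theorem val_act (hk : 2 ≤ k) (x : Artin k) (S : {S : NormalForm // S.Valid k}) :
    (act hk x S).1.val k = x * S.1.val k := by
  have hx : x ∈ Subgroup.closure (Set.range (PresentedGroup.of (rels := rels k))) := by
    rw [PresentedGroup.closure_range_of]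
    trivial
  induction hx using Subgroup.closure_induction generalizing S with
  | mem x hx =>
    obtain ⟨c, rfl⟩ := hx
    change (act hk (gen k c) S).1.val k = gen k c * S.1.val k
    rw [act_gen]
    exact val_mulGen S.2 c
  | one => simp
  | mul x y _ _ hx hy => rw [map_mul, Equiv.Perm.mul_apply, hx, hy, mul_assoc]
  | inv x _ hx =>
    have := hx (act hk x⁻¹ S)
    rw [← Equiv.Perm.mul_apply, ← map_mul, mul_inv_cancel, map_one, Equiv.Perm.one_apply] at this
    rw [this, inv_mul_cancel_left]

/-- The normal form of the identity. -/
def trivial (k : ℕ) : {S : NormalForm // S.Valid k} :=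
  ⟨⟨0, false, []⟩, by simp [Valid]⟩

theorem val_act_trivial (hk : 2 ≤ k) (x : Artin k) : (act hk x (trivial k)).1.val k = x := by
  rw [val_act]
  simp [trivial, val, posVal]

theorem size_trivial : (trivial k).1.size k = 0 := by
  simp [trivial, size, level]

theorem mem_gens_iff {g : Artin k} : g ∈ gens k ↔ ∃ c, g = gen k c ∨ g = (gen k c)⁻¹ := by
  simp only [gens, Set.mem_insert_iff, Set.mem_singleton_iff, Bool.exists_bool]
  change g = gen k false ∨ g = gen k true ∨ g = (gen k false)⁻¹ ∨ g = (gen k true)⁻¹ ↔ _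
  tauto

theorem size_act_le (hk : 2 ≤ k) (w : List (Artin k)) (hw : ∀ g ∈ w, g ∈ gens k) :
    (act hk w.prod (trivial k)).1.size k ≤ w.length := by
  induction w with
  | nil => simp [size_trivial]
  | cons g w ih =>
    rw [List.prod_cons, map_mul, Equiv.Perm.mul_apply, List.length_cons]
    have ih := ih fun g hg => hw g (by simp [hg])
    obtain ⟨c, rfl | rfl⟩ := mem_gens_iff.mp (hw g (by simp))
    · have := abs_le.mp (abs_size_mulGen_sub hk (act hk w.prod (trivial k)).2 c)
      rw [act_gen]
      change (mulGen k c _).size k ≤ _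
      push_cast
      linarith
    · have := abs_le.mp (abs_size_invMulGen_sub hk (act hk w.prod (trivial k)).2 c)
      rw [act_gen_inv]
      push_cast
      linarith

/-- Descent by `exists_size_lt`; each step towards the trivial form contributes the inverse of its
letter. -/
theorem exists_word (hk : 2 ≤ k) (n : ℕ) (S : {S : NormalForm // S.Valid k})
    (hn : S.1.size k = n) : ∃ w : List (Artin k), (∀ g ∈ w, g ∈ gens k) ∧ w.length = n ∧
      act hk w.prod (trivial k) = S := by
  induction n generalizing S with
  | zero =>
    rcases exists_size_lt hk S.2 with h | ⟨g, h | h⟩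
    · exact ⟨[], by simp, rfl, Subtype.ext h.symm⟩
    · have := size_nonneg (k := k) (S.1.mulGen k g)
      omega
    · have := size_nonneg (k := k) (S.1.invMulGen k g)
      omega
  | succ n ih =>
    rcases exists_size_lt hk S.2 with h | ⟨g, h | h⟩
    · have h' : S = trivial k := Subtype.ext h
      rw [h', size_trivial] at hn
      omega
    · obtain ⟨w, hw, hl, hS⟩ := ih (act hk (gen k g) S) (by
        rw [act_gen]
        change (mulGen k g _).size k = _
        omega)
      refine ⟨(gen k g)⁻¹ :: w, ?_, by simp [hl], ?_⟩
      · exact List.forall_mem_cons.mpr ⟨mem_gens_iff.mpr ⟨g, Or.inr rfl⟩, hw⟩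
      · rw [List.prod_cons, map_mul, Equiv.Perm.mul_apply, hS, ← Equiv.Perm.mul_apply, ← map_mul]
        simp
    · obtain ⟨w, hw, hl, hS⟩ := ih (act hk (gen k g)⁻¹ S) (by
        rw [act_gen_inv]
        omega)
      refine ⟨gen k g :: w, ?_, by simp [hl], ?_⟩
      · exact List.forall_mem_cons.mpr ⟨mem_gens_iff.mpr ⟨g, Or.inl rfl⟩, hw⟩
      · rw [List.prod_cons, map_mul, Equiv.Perm.mul_apply, hS, ← Equiv.Perm.mul_apply, ← map_mul]
        simp

theorem wordDist_eq_size (hk : 2 ≤ k) (x : Artin k) :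
    (wordDist (gens k) 1 x : ℤ) = (act hk x (trivial k)).1.size k := by
  obtain ⟨n, hn⟩ := Int.eq_ofNat_of_zero_le (size_nonneg (k := k) (act hk x (trivial k)).1)
  obtain ⟨w, hw, hl, hS⟩ := exists_word hk n _ hn
  have hx : w.prod = x := by
    rw [← val_act_trivial hk w.prod, hS, val_act_trivial]
  apply le_antisymm
  · rw [hn]
    have : n ∈ pathLengths (gens k) 1 x := ⟨w, hw, by rw [one_mul, hx], hl⟩
    exact Int.ofNat_le.mpr (Nat.sInf_le this)
  -- Nonemptiness ensures that the infimum is attained, and is not the default value `0`.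
  · obtain ⟨v, hv, hvx, hvl⟩ := Nat.sInf_mem (pathLengths_gens_nonempty k 1 x)
    rw [one_mul] at hvx
    have := size_act_le hk v hv
    rw [hvx, hvl] at this
    exact this

/-! ### Comparison with left normal forms. -/

theorem act_garside (hk : 2 ≤ k) (S : {S : NormalForm // S.Valid k}) :
    (act hk (garside k) S).1.exp = S.1.exp + 1 ∧
      (act hk (garside k) S).1.lens = S.1.lens := by
  rw [← alt_eq_garside false, act_alt, mulAlt_garside hk S.2]
  exact ⟨rfl, rfl⟩

theorem act_garside_zpow (hk : 2 ≤ k) (r : ℤ) (S : {S : NormalForm // S.Valid k}) :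
    (act hk (garside k ^ r) S).1.exp = r + S.1.exp ∧
      (act hk (garside k ^ r) S).1.lens = S.1.lens := by
  induction r using Int.induction_on with
  | zero => simp
  | succ n ih =>
    have := act_garside hk (act hk (garside k ^ (n : ℤ)) S)
    rw [← Equiv.Perm.mul_apply, ← map_mul, ← zpow_one_add, ih.1, ih.2, add_comm] at this
    exact ⟨this.1.trans (by ring), this.2⟩
  | pred n ih =>
    have := act_garside hk (act hk (garside k ^ (-n - 1 : ℤ)) S)
    rw [← Equiv.Perm.mul_apply, ← map_mul, ← zpow_one_add, add_sub_cancel, ih.1, ih.2] at this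
    exact ⟨by omega, this.2.symm⟩

theorem exists_posVal_mul_zpow (e : Bool) (L : List ℕ) (r : ℤ) :
    ∃ e', posVal k e L * garside k ^ r = garside k ^ r * posVal k e' L := by
  have key : ∀ e, posVal k e L * garside k = garside k * posVal k (e ^^ k.bodd) L := by
    intro e
    rw [garside_mul_posVal, Bool.xor_assoc, Bool.xor_self, Bool.xor_false]
  induction r using Int.induction_on with
  | zero => exact ⟨e, by simp⟩
  | succ n ih =>
    obtain ⟨e', h⟩ := ih
    exact ⟨e' ^^ k.bodd, by rw [zpow_add_one, ← mul_assoc, h, mul_assoc, key, mul_assoc]⟩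
  | pred n ih =>
    obtain ⟨e', h⟩ := ih
    refine ⟨e' ^^ k.bodd, ?_⟩
    rw [zpow_sub_one, ← mul_assoc, h, mul_assoc, mul_assoc, mul_right_inj, mul_inv_eq_iff_eq_mul,
      mul_assoc, ← garside_mul_posVal, inv_mul_cancel_left]

theorem exists_factors (e : Bool) (L : List ℕ) (hL : ∀ l ∈ L, 1 ≤ l ∧ l < k) :
    ∃ z : List (Artin k), (∀ y ∈ z, y ∈ canonicalFactors k) ∧ z.length = L.length ∧
      z.prod = posVal k e L := by
  induction L generalizing e with
  | nil => exact ⟨[], by simp, rfl, rfl⟩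
  | cons l L ih =>
    simp only [List.mem_cons, forall_eq_or_imp] at hL
    obtain ⟨z, hz, hl, hp⟩ := ih (e ^^ (l + 1).bodd) hL.2
    refine ⟨alt k (!e) l :: z, ?_, by simp [hl], by rw [List.prod_cons, hp, posVal]⟩
    simp only [List.mem_cons, forall_eq_or_imp]
    exact ⟨⟨l, hL.1.1, hL.1.2, hasLength_iff.mpr ⟨_, rfl⟩⟩, hz⟩

theorem exists_isLeftDecomposition (hk : 2 ≤ k) (x : Artin k) :
    ∃ r z, IsLeftDecomposition x r z ∧ z.length = (act hk x (trivial k)).1.lens.length := by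
  set S := act hk x (trivial k)
  have hx : S.1.val k = x := val_act_trivial hk x
  obtain ⟨e, he⟩ := exists_posVal_mul_zpow (k := k) S.1.letter S.1.lens S.1.exp
  obtain ⟨z, hz, hl, hp⟩ := exists_factors (k := k) e S.1.lens S.2.1
  exact ⟨S.1.exp, z, ⟨hz, by rw [hp, ← he, ← hx, val]⟩, hl⟩

/-- By `mulAlt_dichotomy` each factor of `z` adds at most one factor to the normal form, so a factor
once lost is never made up for. -/
theorem act_prod_dichotomy (hk : 2 ≤ k) (z : List (Artin k))
    (hz : ∀ y ∈ z, y ∈ canonicalFactors k) :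
    ∃ L, List.Forall₂ (HasLength k) L z ∧
      (((act hk z.prod (trivial k)).1.exp = 0 ∧ (act hk z.prod (trivial k)).1.lens = L) ∨
        (act hk z.prod (trivial k)).1.lens.length < z.length) := by
  induction z with
  | nil => exact ⟨[], by simp, Or.inl (by simp [trivial])⟩
  | cons y z ih =>
    simp only [List.mem_cons, forall_eq_or_imp] at hz
    obtain ⟨⟨l, h1, h2, h3⟩, hz⟩ := hz
    obtain ⟨L, hL, h⟩ := ih hz
    refine ⟨l :: L, .cons h3 hL, ?_⟩
    obtain ⟨c, rfl⟩ := hasLength_iff.mp h3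
    have hlen := hL.length_eq
    rw [List.prod_cons, map_mul, Equiv.Perm.mul_apply, act_alt, List.length_cons]
    rcases mulAlt_dichotomy h1 h2 (act hk z.prod (trivial k)).2 c with ⟨h4, h5⟩ | h4
    · rcases h with ⟨h6, h7⟩ | h6
      · exact Or.inl ⟨h4.trans h6, h5.trans (by rw [h7])⟩
      · right
        exact lt_of_eq_of_lt (congrArg List.length h5) (Nat.succ_lt_succ h6)
    · right
      refine lt_of_le_of_lt h4 ?_
      rcases h with ⟨-, h7⟩ | h6
      · rw [h7]; omega
      · exact h6.trans (Nat.lt_succ_self _)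

/-- The left normal form of `x` is the one computed by the action on normal forms. -/
theorem act_of_isLeftNormalForm (hk : 2 ≤ k) {x : Artin k} {r : ℤ} {z : List (Artin k)}
    (h : IsLeftNormalForm x r z) :
    (act hk x (trivial k)).1.exp = r ∧
      List.Forall₂ (HasLength k) (act hk x (trivial k)).1.lens z := by
  obtain ⟨L, hL, hd⟩ := act_prod_dichotomy hk z h.1.1
  have hr := act_garside_zpow hk r (act hk z.prod (trivial k))
  rw [← Equiv.Perm.mul_apply, ← map_mul, ← h.1.2] at hr
  obtain ⟨r', z', hz', hl⟩ := exists_isLeftDecomposition hk x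
  have hmin := h.2 r' z' hz'
  rcases hd with ⟨h1, h2⟩ | h1
  · exact ⟨by rw [hr.1, h1, add_zero], by rw [hr.2, h2]; exact hL⟩
  -- The computed normal form would yield a decomposition with fewer factors than `z`.
  · rw [hl, hr.2] at hmin
    omega

end NormalForm

/-! ### Counting factors by length. -/

/-- The homomorphism to `ℤ` that sends both generators to `1`. -/
def degree (k : ℕ) : Artin k →* Multiplicative ℤ :=
  PresentedGroup.toGroup (f := fun _ => Multiplicative.ofAdd 1) (by
    rintro w rfl
    rw [map_mul, map_inv, map_altProd, map_altProd, mul_inv_eq_one]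
    simp only [FreeGroup.lift_apply_of])

variable {k : ℕ}

theorem degree_alt (c : Bool) (n : ℕ) : degree k (alt k c n) = Multiplicative.ofAdd (n : ℤ) := by
  induction n generalizing c with
  | zero => simp [alt_zero]
  | succ n ih =>
    have : degree k (gen k c) = Multiplicative.ofAdd 1 := PresentedGroup.toGroup.of _
    rw [alt_succ, map_mul, ih, this, ← ofAdd_add]
    push_cast
    rw [add_comm]

/-- The length is the degree, hence determined by the group element. -/
theorem HasLength.unique {m n : ℕ} {y : Artin k} (hm : HasLength k m y) (hn : HasLength k n y) :
    m = n := by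
  obtain ⟨c, rfl⟩ := hasLength_iff.mp hm
  obtain ⟨d, hd⟩ := hasLength_iff.mp hn
  have := congrArg (degree k) hd
  rw [degree_alt, degree_alt] at this
  exact_mod_cast Multiplicative.ofAdd.injective this

theorem numOfLength_eq_count {L : List ℕ} {z : List (Artin k)}
    (h : List.Forall₂ (HasLength k) L z) (i : ℕ) : numOfLength z i = L.count i := by
  induction h with
  | nil => simp [numOfLength]
  | @cons l y L z hl _ ih =>
    have : HasLength k i y ↔ l = i := ⟨fun h => hl.unique h, fun h => h ▸ hl⟩
    rw [numOfLength, List.countP_cons, List.count_cons, ← ih, numOfLength]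
    simp [this]

theorem NormalForm.level_zero {S : NormalForm} (h : S.Valid k) : S.level k 0 = S.exp := by
  have : S.lens.countP (fun l => decide (k ≤ l + 0)) = 0 := by
    refine List.countP_eq_zero.mpr fun l hl => ?_
    have := (h.1 l hl).2
    simp
    omega
  rw [level, this]
  simp

/-- Passing from `i` to `i + 1` newly counts the factors of length exactly `k - (i + 1)`. This is
the recurrence that defines `p`. -/
theorem NormalForm.level_succ_sub (S : NormalForm) {i : ℕ} (hi : i + 1 ≤ k) :
    S.level k (i + 1) - S.level k i = S.lens.count (k - (i + 1)) := by
  obtain ⟨r, e, L⟩ := S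
  induction L with
  | nil => simp [level]
  | cons l L ih =>
    simp only [level, List.countP_cons, List.count_cons] at ih ⊢
    by_cases h1 : k ≤ l + i
    · have h2 : k ≤ l + (i + 1) := by omega
      have h3 : l ≠ k - (i + 1) := by omega
      simp [h1, h2, h3]
      linarith
    · by_cases h2 : k ≤ l + (i + 1)
      · have h3 : l = k - (i + 1) := by omega
        simp only [h1, h2, ← h3] at ih ⊢
        simp
        linarith
      · have h3 : l ≠ k - (i + 1) := by omega
        simp [h1, h2, h3]
        linarith

end ArtinDihedral

open ArtinDihedral in
theorem proposition2p1 (k : ℕ) (hk : 3 ≤ k) (x : ArtinDihedral.Artin k)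
    (r : ℤ) (z : List (ArtinDihedral.Artin k))
    (hx : ArtinDihedral.IsLeftNormalForm x r z)
    (p : Fin k → ℤ)
    (hp0 : p ⟨0, by omega⟩ = r)
    (hp : ∀ i : ℕ, ∀ _ : 1 ≤ i, ∀ _ : i ≤ k - 1,
      p ⟨i, by omega⟩ - p ⟨i - 1, by omega⟩ =
        (ArtinDihedral.numOfLength z (k - i) : ℤ)) :
    (ArtinDihedral.wordDist (ArtinDihedral.gens k) 1 x : ℤ) = ∑ i : Fin k, |p i| := by
  have hk2 : 2 ≤ k := by omega
  obtain ⟨hr, hz⟩ := NormalForm.act_of_isLeftNormalForm hk2 hx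
  rw [NormalForm.wordDist_eq_size hk2, NormalForm.size, Finset.sum_range]
  generalize NormalForm.act hk2 x (NormalForm.trivial k) = S at hr hz
  have key : ∀ i (hi : i < k), S.1.level k i = p ⟨i, hi⟩ := by
    intro i
    induction i with
    | zero => intro _; rw [NormalForm.level_zero S.2, hr, hp0]
    | succ i ih =>
      intro hi
      have h1 := hp (i + 1) (by omega) (by omega)
      have h2 := NormalForm.level_succ_sub S.1 (k := k) (i := i) (by omega)
      rw [numOfLength_eq_count hz, ← h2, ih (by omega)] at h1
      simp only [Nat.add_sub_cancel] at h1
      linarith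
  exact Finset.sum_congr rfl fun i _ => by rw [key i i.2]
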